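/- Let $L$ be a Lie conformal algebra over $\mathbb{C}$, that is, a $\mathbb{C}[\partial]$-module with a $\mathbb{C}$-linear $\lambda$-bracket $L\otimes L\to\mathbb{C}[\lambda]\otimes L$, $a\otimes b\mapsto[a_\lambda b]$, such that $[\partial a_\lambda b]=-\lambda[a_\lambda b]$, $[a_\lambda\partial b]=(\lambda+\partial)[a_\lambda b]$, $[a_\lambda b]=-[b_{-\lambda-\partial}\,a]$ and $[a_\lambda[b_\mu c]]=[[a_\lambda b]_{\lambda+\mu}c]+[b_\mu[a_\lambda c]]$ (all tensor products are over $\mathbb{C}$). Call $L$ simple if $[L_\lambda L]\neq 0$ and its only ideals are $0$ and $L$. Let $L^{*c}$ be the conformal dual of $L$, the space of $\mathbb{C}$-linear maps $f:L\to\mathbb{C}[\lambda]$ with $f_\lambda(\partial b)=\lambda f_\lambda(b)$, made a $\mathbb{C}[\partial]$-module by $(\partial f)_\lambda=-\lambda f_\lambda$. For $f,g\in L^{*c}$ and $a,b\in L$ put $$[\Phi_\mu(f\otimes g)]_\lambda(a\otimes b)=f_\mu(a)\,g_{\lambda-\mu}(b),\qquad [\pi_\mu(f)]_\lambda(a\otimes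 b)=f_\lambda([a_\mu b]).$$ A $\mathbb{C}[\partial]$-submodule $V\subseteq L^{*c}$ is called good if $\pi_\mu(V)\subseteq\Phi_{-\mu}(V\otimes V)$. Let $L^0$ be the sum of all good submodules of $L^{*c}$. It is itself good, and is a differential Lie coalgebra with the coproduct $\delta:L^0\to L^0\otimes L^0$ determined by $\Phi_{-\mu}(\delta(f))=\pi_\mu(f)$. For a differential Lie coalgebra $M$, let $\operatorname{Loc}(M)$ be the sum of all subcoalgebras of $M$ (that is, $\mathbb{C}[\partial]$-submodules $N$ with $\delta(N)\subseteq N\otimes N$) that have finite rank over $\mathbb{C}[\partial]$. If $L$ is simple and has infinite rank as a $\mathbb{C}[\partial]$-module, then $\operatorname{Loc}(L^0)=0$. -/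

import Mathlib

open Polynomial TensorProduct

noncomputable section

namespace LieConf

/-! A `ℂ[∂]`-module is a complex vector space `L` with a compatible `ℂ[X]`-module structure, where
`X` is the derivation `∂`. All unadorned tensor products in this file are over `ℂ`.

A polynomial in formal variables `λ, μ, …` with coefficients in a complex vector space is determined
by its values at complex numbers, so identities between such polynomials are stated as identities
between their values at all complex `λ, μ, …`. -/

section Modules

variable (V : Type*) [AddCommGroup V] [Module ℂ V] [Module ℂ[X] V] [IsScalarTower ℂ ℂ[X] V]

/-- The action of `∂` as a `ℂ`-linear endomorphism. -/
def der : V →ₗ[ℂ] V where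
  toFun v := (X : ℂ[X]) • v
  map_add' := smul_add _
  map_smul' c v := by
    simp only [RingHom.id_apply]
    rw [← algebraMap_smul ℂ[X] c v, ← algebraMap_smul ℂ[X] c ((X : ℂ[X]) • v), smul_smul,
      smul_smul, mul_comm]

/-- The rank of a `ℂ[∂]`-module is finite. -/
def HasFiniteRank (V : Type*) [AddCommGroup V] [Module ℂ[X] V] : Prop :=
  Module.rank ℂ[X] V < Cardinal.aleph0

variable {V}

@[simp] lemma der_apply (v : V) : der V v = (X : ℂ[X]) • v := rfl

/-- Substitution of an operator `T` for the variable in an element of `ℂ[λ] ⊗ V`: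
`p(λ) ⊗ v ↦ p(T) v`. -/
def subst {V : Type*} [AddCommGroup V] [Module ℂ V] (T : Module.End ℂ V) :
    ℂ[X] ⊗[ℂ] V →ₗ[ℂ] V :=
  TensorProduct.lift (aeval T).toLinearMap

/-- The value of an element of `ℂ[λ] ⊗ V` at `λ = c`: `p(λ) ⊗ v ↦ p(c) v`. -/
def evalAt {V : Type*} [AddCommGroup V] [Module ℂ V] (c : ℂ) : ℂ[X] ⊗[ℂ] V →ₗ[ℂ] V :=
  subst (c • LinearMap.id)

end Modules

/-- Lie conformal algebras. The four axioms are
`[∂a_λ b] = -λ [a_λ b]`, `[a_λ ∂b] = (λ + ∂) [a_λ b]`, `[a_λ b] = -[b_{-λ-∂} a]` and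
`[a_λ [b_μ c]] = [[a_λ b]_{λ+μ} c] + [b_μ [a_λ c]]`. -/
class LieConformalAlgebra (L : Type*) [AddCommGroup L] [Module ℂ L] [Module ℂ[X] L]
    [IsScalarTower ℂ ℂ[X] L] where
  /-- The `λ`-bracket `a ⊗ b ↦ [a_λ b] ∈ ℂ[λ] ⊗ L`. -/
  bracket : L →ₗ[ℂ] L →ₗ[ℂ] ℂ[X] ⊗[ℂ] L
  der_bracket : ∀ (l : ℂ) (a b : L),
    evalAt l (bracket ((X : ℂ[X]) • a) b) = -l • evalAt l (bracket a b)
  bracket_der : ∀ (l : ℂ) (a b : L),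
    evalAt l (bracket a ((X : ℂ[X]) • b)) =
      l • evalAt l (bracket a b) + (X : ℂ[X]) • evalAt l (bracket a b)
  skew : ∀ (l : ℂ) (a b : L),
    evalAt l (bracket a b) = -subst (-(l • LinearMap.id) - der L) (bracket b a)
  jacobi : ∀ (l m : ℂ) (a b c : L),
    evalAt l (bracket a (evalAt m (bracket b c))) =
      evalAt (l + m) (bracket (evalAt l (bracket a b)) c) +
        evalAt m (bracket b (evalAt l (bracket a c)))

section Algebra

variable {L : Type*} [AddCommGroup L] [Module ℂ L] [Module ℂ[X] L] [IsScalarTower ℂ ℂ[X] L]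
  [LieConformalAlgebra L]

/-- The value `[a_l b]` of the `λ`-bracket at `λ = l`. -/
def br (l : ℂ) (a b : L) : L := evalAt l (LieConformalAlgebra.bracket a b)

/-- `I` is an ideal: `[a_λ b] ∈ ℂ[λ] ⊗ I` for all `a ∈ L` and `b ∈ I`. -/
def IsIdeal (I : Submodule ℂ[X] L) : Prop :=
  ∀ (a b : L), b ∈ I → ∀ l : ℂ, br l a b ∈ I

variable (L) in
/-- `L` is simple: `[L_λ L] ≠ 0`, and the only ideals are `0` and `L`. -/
def IsSimple : Prop :=
  (∃ a b : L, LieConformalAlgebra.bracket a b ≠ 0) ∧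
    ∀ I : Submodule ℂ[X] L, IsIdeal I → I = ⊥ ∨ I = ⊤

end Algebra

section Dual

variable (U : Type*) [AddCommGroup U] [Module ℂ U] [Module ℂ[X] U]

/-- The set of `ℂ`-linear `f : U → ℂ[λ]` with `f_λ(∂b) = λ f_λ(b)`, as a submodule of the space of
all linear maps for multiplication by polynomials in `λ`. -/
def conformalMaps : Submodule ℂ[X] (U →ₗ[ℂ] ℂ[X]) where
  carrier := {f | ∀ b : U, f ((X : ℂ[X]) • b) = X * f b}
  add_mem' {f g} hf hg b := by
    simp only [Set.mem_ofPred_eq] at hf hg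
    simp [hf, hg, mul_add]
  zero_mem' b := by simp
  smul_mem' p f hf b := by
    simp only [Set.mem_ofPred_eq] at hf
    simp only [LinearMap.smul_apply, hf, smul_eq_mul]
    ring

/-- The conformal dual of a `ℂ[∂]`-module. -/
def ConformalDual : Type _ := ↥(conformalMaps U)

instance : AddCommGroup (ConformalDual U) := inferInstanceAs (AddCommGroup ↥(conformalMaps U))

instance : Module ℂ (ConformalDual U) := inferInstanceAs (Module ℂ ↥(conformalMaps U))

/-- `∂` acts on the conformal dual by `(∂f)_λ = -λ f_λ`; hence `p(∂)` acts by `p(-λ)`. -/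
instance : Module ℂ[X] (ConformalDual U) :=
  letI : Module ℂ[X] (ConformalDual U) := inferInstanceAs (Module ℂ[X] ↥(conformalMaps U))
  Module.compHom (ConformalDual U) (compRingHom (-X : ℂ[X]))

variable {U}

/-- `f.val c b` is `f_c(b)`, the value at `λ = c` of the polynomial `f_λ(b)`. -/
def ConformalDual.val (c : ℂ) (b : U) : ConformalDual U →ₗ[ℂ] ℂ where
  toFun f := (f.1 b).eval c
  map_add' f g := by
    change ((f.1 + g.1) b).eval c = _
    simp
  map_smul' r f := by
    change ((r • f.1) b).eval c = _
    simp

lemma ConformalDual.val_smul (p : ℂ[X]) (c : ℂ) (b : U) (f : ConformalDual U) :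
    ConformalDual.val c b (p • f) = p.eval (-c) * ConformalDual.val c b f := by
  change ((p.comp (-X) • f.1) b).eval c = p.eval (-c) * (f.1 b).eval c
  simp [eval_comp]

lemma ConformalDual.ext_val {f g : ConformalDual U}
    (h : ∀ (c : ℂ) (b : U), ConformalDual.val c b f = ConformalDual.val c b g) : f = g := by
  apply Subtype.ext
  apply LinearMap.ext
  intro b
  exact Polynomial.funext fun c => h c b

instance : IsScalarTower ℂ ℂ[X] (ConformalDual U) where
  smul_assoc r p f := by
    apply ConformalDual.ext_val
    intro c b
    simp [ConformalDual.val_smul, mul_assoc]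

@[simp] lemma ConformalDual.val_add_right (f : ConformalDual U) (c : ℂ) (a b : U) :
    ConformalDual.val c (a + b) f = ConformalDual.val c a f + ConformalDual.val c b f := by
  simp [ConformalDual.val]

@[simp] lemma ConformalDual.val_neg_right (f : ConformalDual U) (c : ℂ) (a : U) :
    ConformalDual.val c (-a) f = -ConformalDual.val c a f := by
  simp [ConformalDual.val]

@[simp] lemma ConformalDual.val_smul_right (f : ConformalDual U) (c r : ℂ) (a : U) :
    ConformalDual.val c (r • a) f = r * ConformalDual.val c a f := by
  simp [ConformalDual.val]

@[simp] lemma ConformalDual.val_der_right (f : ConformalDual U) (c : ℂ) (a : U) :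
    ConformalDual.val c ((X : ℂ[X]) • a) f = c * ConformalDual.val c a f := by
  have h := f.2 a
  simp only [ConformalDual.val, LinearMap.coe_mk, AddHom.coe_mk]
  rw [h]
  simp

end Dual

section Tensor

/-- The tensor product of two functionals, `v ⊗ w ↦ φ(v) ψ(w)`. -/
def tmulDual {V W : Type*} [AddCommGroup V] [Module ℂ V] [AddCommGroup W] [Module ℂ W]
    (φ : V →ₗ[ℂ] ℂ) (ψ : W →ₗ[ℂ] ℂ) : V ⊗[ℂ] W →ₗ[ℂ] ℂ :=
  LinearMap.mul' ℂ ℂ ∘ₗ TensorProduct.map φ ψ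

@[simp] lemma tmulDual_tmul {V W : Type*} [AddCommGroup V] [Module ℂ V] [AddCommGroup W]
    [Module ℂ W] (φ : V →ₗ[ℂ] ℂ) (ψ : W →ₗ[ℂ] ℂ) (v : V) (w : W) :
    tmulDual φ ψ (v ⊗ₜ w) = φ v * ψ w := by
  simp [tmulDual]

/-- Products of separating families of functionals separate the points of a tensor product. -/
lemma tmulDual_separating {V W ι κ : Type*} [AddCommGroup V] [Module ℂ V] [AddCommGroup W]
    [Module ℂ W] (φ : ι → V →ₗ[ℂ] ℂ) (ψ : κ → W →ₗ[ℂ] ℂ)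
    (hφ : ∀ v, (∀ i, φ i v = 0) → v = 0) (hψ : ∀ w, (∀ k, ψ k w = 0) → w = 0)
    (t : V ⊗[ℂ] W) (h : ∀ i k, tmulDual (φ i) (ψ k) t = 0) : t = 0 := by
  have h1 : ∀ i, (TensorProduct.lid ℂ W) (LinearMap.rTensor W (φ i) t) = 0 := by
    intro i
    apply hψ
    intro k
    rw [← h i k]
    generalize t = s
    induction s with
    | zero => simp
    | tmul x y => simp
    | add x y hx hy => simp only [map_add, hx, hy]
  let b := Module.Free.chooseBasis ℂ W
  apply (TensorProduct.equivFinsuppOfBasisRight b).injective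
  rw [map_zero]
  ext j
  apply hφ
  intro i
  have h2 : φ i (TensorProduct.equivFinsuppOfBasisRight b t j) =
      b.repr ((TensorProduct.lid ℂ W) (LinearMap.rTensor W (φ i) t)) j := by
    generalize t = s
    induction s with
    | zero => simp
    | tmul x y => simp [mul_comm]
    | add x y hx hy => simp only [map_add, Finsupp.add_apply, hx, hy]
  rw [h2, h1]
  simp

end Tensor

/-- Differential Lie coalgebras: `δ` is a homomorphism of `ℂ[∂]`-modules (where `∂` acts on `C ⊗ C`
by `∂ ⊗ 1 + 1 ⊗ ∂`), `τ ∘ δ = -δ`, and `(I ⊗ δ)δ - (τ ⊗ I)(I ⊗ δ)δ = (δ ⊗ I)δ`. Here triple tensor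
products are bracketed as `C ⊗ (C ⊗ C)`, so that `τ ⊗ I` is `TensorProduct.leftComm`. -/
class DiffLieCoalgebra (C : Type*) [AddCommGroup C] [Module ℂ C] [Module ℂ[X] C]
    [IsScalarTower ℂ ℂ[X] C] where
  /-- The coproduct. -/
  comul : C →ₗ[ℂ] C ⊗[ℂ] C
  comul_der : ∀ c : C, comul ((X : ℂ[X]) • c) =
    TensorProduct.map (der C) LinearMap.id (comul c) +
      TensorProduct.map LinearMap.id (der C) (comul c)
  coskew : ∀ c : C, TensorProduct.comm ℂ C C (comul c) = -comul c
  cojacobi : ∀ c : C,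
    TensorProduct.map LinearMap.id comul (comul c) -
        TensorProduct.leftComm ℂ C C C (TensorProduct.map LinearMap.id comul (comul c)) =
      TensorProduct.assoc ℂ C C C (TensorProduct.map comul LinearMap.id (comul c))

/-- The canonical map `N ⊗ N → C ⊗ C` for a `ℂ[∂]`-submodule `N` of `C`. -/
def tensorIncl {C : Type*} [AddCommGroup C] [Module ℂ C] [Module ℂ[X] C] [IsScalarTower ℂ ℂ[X] C]
    (N : Submodule ℂ[X] C) : N ⊗[ℂ] N →ₗ[ℂ] C ⊗[ℂ] C :=
  TensorProduct.map (N.subtype.restrictScalars ℂ) (N.subtype.restrictScalars ℂ)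

section Coalgebra

variable {C : Type*} [AddCommGroup C] [Module ℂ C] [Module ℂ[X] C] [IsScalarTower ℂ ℂ[X] C]
  [DiffLieCoalgebra C]

/-- `N` is a subcoalgebra: `δ(N) ⊆ N ⊗ N`. -/
def IsSubcoalgebra (N : Submodule ℂ[X] C) : Prop :=
  ∀ c ∈ N, DiffLieCoalgebra.comul c ∈ LinearMap.range (tensorIncl N)

variable (C) in
/-- The locally finite part: the sum of all subcoalgebras of finite rank. -/
def Loc : Submodule ℂ[X] C :=
  sSup {N : Submodule ℂ[X] C | IsSubcoalgebra N ∧ HasFiniteRank N}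

end Coalgebra

section UpperZero

variable {L : Type*} [AddCommGroup L] [Module ℂ L] [Module ℂ[X] L] [IsScalarTower ℂ ℂ[X] L]

/-- `phiMap m l t a b` is `[Φ_m(t)]_l(a ⊗ b)`, where `[Φ_μ(f ⊗ g)]_λ(a ⊗ b) = f_μ(a) g_{λ-μ}(b)`. -/
def phiMap (m l : ℂ) (t : ConformalDual L ⊗[ℂ] ConformalDual L) (a b : L) : ℂ :=
  tmulDual (ConformalDual.val m a) (ConformalDual.val (l - m) b) t

/-- `f_s(P(-c-∂)) = f_s(P(-c-s))` for `P ∈ ℂ[λ] ⊗ L`. -/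
lemma val_subst (f : ConformalDual L) (s c : ℂ) (P : ℂ[X] ⊗[ℂ] L) :
    ConformalDual.val s (subst (-(c • LinearMap.id) - der L) P) f =
      ConformalDual.val s (evalAt (-c - s) P) f := by
  induction P with
  | zero => simp
  | add x y hx hy => simp only [map_add, ConformalDual.val_add_right, hx, hy]
  | tmul p v =>
    have key : ∀ T : Module.End ℂ L,
        (∀ w, ConformalDual.val s (T w) f = (-c - s) * ConformalDual.val s w f) →
        ConformalDual.val s (subst T (p ⊗ₜ v)) f =
          p.eval (-c - s) * ConformalDual.val s v f := by
      intro T hT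
      simp only [subst, TensorProduct.lift.tmul, AlgHom.toLinearMap_apply]
      induction p using Polynomial.induction_on' with
      | add p q hp hq => simp only [map_add, LinearMap.add_apply, ConformalDual.val_add_right,
          hp, hq, eval_add, add_mul]
      | monomial n r =>
        have hn : ∀ w, ConformalDual.val s ((T ^ n) w) f =
            (-c - s) ^ n * ConformalDual.val s w f := by
          induction n with
          | zero => simp
          | succ n ih =>
            intro w
            rw [pow_succ, Module.End.mul_apply, ih, hT]
            ring
        rw [aeval_monomial, Module.End.mul_apply, Module.algebraMap_end_apply,
          ConformalDual.val_smul_right, hn, eval_monomial]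
        ring
    rw [evalAt, key, key]
    · intro w
      simp
    · intro w
      simp only [sub_eq_add_neg, LinearMap.add_apply, LinearMap.neg_apply, LinearMap.smul_apply,
        LinearMap.id_apply, der_apply, ConformalDual.val_add_right, ConformalDual.val_neg_right,
        ConformalDual.val_smul_right, ConformalDual.val_der_right]
      ring

variable [LieConformalAlgebra L]

/-- `piMap m l f a b` is `[π_m(f)]_l(a ⊗ b)`, where `[π_μ(f)]_λ(a ⊗ b) = f_λ([a_μ b])`. -/
def piMap (m l : ℂ) (f : ConformalDual L) (a b : L) : ℂ :=
  ConformalDual.val l (br m a b) f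

/-- A `ℂ[∂]`-submodule `V` of the conformal dual is good if `π_μ(V) ⊆ Φ_{-μ}(V ⊗ V)`, as an
inclusion between sets of functions of the formal variables `λ, μ`. -/
def IsGood (V : Submodule ℂ[X] (ConformalDual L)) : Prop :=
  ∀ f ∈ V, ∃ t : V ⊗[ℂ] V, ∀ (m l : ℂ) (a b : L), piMap m l f a b = phiMap (-m) l (tensorIncl V t) a b

variable (L) in
/-- The upper zero of `L`: the sum of all good submodules of the conformal dual. -/
def upperZero : Submodule ℂ[X] (ConformalDual L) :=
  sSup {V : Submodule ℂ[X] (ConformalDual L) | IsGood V}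

lemma IsGood.le_upperZero {V : Submodule ℂ[X] (ConformalDual L)} (hV : IsGood V) :
    V ≤ upperZero L := le_sSup hV

lemma isGood_upperZero : IsGood (upperZero L) := by
  intro f hf
  rw [upperZero, sSup_eq_iSup'] at hf
  refine Submodule.iSup_induction _ (motive := fun f => ∃ t : upperZero L ⊗[ℂ] upperZero L,
    ∀ (m l : ℂ) (a b : L), piMap m l f a b = phiMap (-m) l (tensorIncl (upperZero L) t) a b)
    hf ?_ ?_ ?_
  · rintro ⟨V, hV⟩ f hf
    obtain ⟨t, ht⟩ := hV f hf
    let j : V →ₗ[ℂ] upperZero L :=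
      (Submodule.inclusion (IsGood.le_upperZero hV)).restrictScalars ℂ
    refine ⟨TensorProduct.map j j t, fun m l a b => ?_⟩
    rw [ht]
    congr 1
    simp only [tensorIncl]
    rw [← LinearMap.comp_apply, ← TensorProduct.map_comp]
    rfl
  · exact ⟨0, fun m l a b => by simp [piMap, phiMap]⟩
  · rintro f g ⟨s, hs⟩ ⟨t, ht⟩
    refine ⟨s + t, fun m l a b => ?_⟩
    have hs' := hs m l a b
    have ht' := ht m l a b
    simp only [piMap, phiMap] at hs' ht' ⊢
    simp only [map_add, hs', ht']

/-- The functional `f ↦ f_c(a)` on the upper zero. -/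
def val0 (c : ℂ) (a : L) : upperZero L →ₗ[ℂ] ℂ :=
  ConformalDual.val c a ∘ₗ (upperZero L).subtype.restrictScalars ℂ

@[simp] lemma val0_apply (c : ℂ) (a : L) (f : upperZero L) :
    val0 c a f = ConformalDual.val c a f.1 := rfl

lemma val0_separating (f : upperZero L) (h : ∀ p : ℂ × L, val0 p.1 p.2 f = 0) : f = 0 := by
  apply Subtype.ext
  apply ConformalDual.ext_val
  intro c b
  simpa using h (c, b)

lemma val0_tensor_ext {s t : upperZero L ⊗[ℂ] upperZero L}
    (h : ∀ (m n : ℂ) (a b : L), tmulDual (val0 m a) (val0 n b) s =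
      tmulDual (val0 m a) (val0 n b) t) : s = t := by
  rw [← sub_eq_zero]
  refine tmulDual_separating (fun p : ℂ × L => val0 p.1 p.2) (fun p : ℂ × L => val0 p.1 p.2)
    val0_separating val0_separating _ fun p q => ?_
  rw [map_sub, h, sub_self]

lemma phiMap_tensorIncl (m l : ℂ) (t : upperZero L ⊗[ℂ] upperZero L) (a b : L) :
    phiMap m l (tensorIncl (upperZero L) t) a b = tmulDual (val0 m a) (val0 (l - m) b) t := by
  simp only [phiMap, tensorIncl, tmulDual, val0, TensorProduct.map_comp, LinearMap.comp_apply]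

lemma exists_coproduct (f : upperZero L) : ∃ t : upperZero L ⊗[ℂ] upperZero L,
    ∀ (m n : ℂ) (a b : L), tmulDual (val0 m a) (val0 n b) t = val0 (m + n) (br (-m) a b) f := by
  obtain ⟨t, ht⟩ := isGood_upperZero f.1 f.2
  refine ⟨t, fun m n a b => ?_⟩
  have h := ht (-m) (m + n) a b
  rw [phiMap_tensorIncl, neg_neg, add_sub_cancel_left] at h
  exact h.symm

/-- The coproduct `δ` of the upper zero: `δ(f)` is the unique element with
`Φ_{-μ}(δ(f)) = π_μ(f)` (see `phiMap_coproduct`). -/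
def coproduct : upperZero L →ₗ[ℂ] upperZero L ⊗[ℂ] upperZero L where
  toFun f := (exists_coproduct f).choose
  map_add' f g := val0_tensor_ext fun m n a b => by
    rw [map_add, (exists_coproduct f).choose_spec, (exists_coproduct g).choose_spec,
      (exists_coproduct (f + g)).choose_spec, map_add]
  map_smul' c f := val0_tensor_ext fun m n a b => by
    rw [RingHom.id_apply, map_smul, (exists_coproduct f).choose_spec,
      (exists_coproduct (c • f)).choose_spec, map_smul]

lemma coproduct_spec (f : upperZero L) (m n : ℂ) (a b : L) :
    tmulDual (val0 m a) (val0 n b) (coproduct f) = val0 (m + n) (br (-m) a b) f :=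
  (exists_coproduct f).choose_spec m n a b

lemma phiMap_coproduct (f : upperZero L) (m l : ℂ) (a b : L) :
    phiMap (-m) l (tensorIncl (upperZero L) (coproduct f)) a b = piMap m l f.1 a b := by
  rw [phiMap_tensorIncl, coproduct_spec]
  simp [piMap]

lemma val_br_skew (f : ConformalDual L) (s m : ℂ) (a b : L) :
    ConformalDual.val s (br m a b) f = -ConformalDual.val s (br (-m - s) b a) f := by
  rw [br, LieConformalAlgebra.skew, ConformalDual.val_neg_right, val_subst, br]

lemma br_jacobi (l m : ℂ) (a b c : L) :
    br l a (br m b c) = br (l + m) (br l a b) c + br m b (br l a c) :=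
  LieConformalAlgebra.jacobi l m a b c

variable (L) in
/-- The upper zero of a Lie conformal algebra is a differential Lie coalgebra. -/
instance : DiffLieCoalgebra (upperZero L) where
  comul := coproduct
  comul_der f := by
    apply val0_tensor_ext
    intro m n a b
    rw [coproduct_spec, map_add]
    have h1 : tmulDual (val0 m a) (val0 n b)
        (TensorProduct.map (der (upperZero L)) LinearMap.id (coproduct f)) =
        -m * tmulDual (val0 m a) (val0 n b) (coproduct f) := by
      generalize coproduct f = s
      induction s with
      | zero => simp
      | tmul x y => simp [ConformalDual.val_smul, mul_assoc]
      | add x y hx hy => simp only [map_add, hx, hy, mul_add]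
    have h2 : tmulDual (val0 m a) (val0 n b)
        (TensorProduct.map LinearMap.id (der (upperZero L)) (coproduct f)) =
        -n * tmulDual (val0 m a) (val0 n b) (coproduct f) := by
      generalize coproduct f = s
      induction s with
      | zero => simp
      | tmul x y => simp [ConformalDual.val_smul]; ring
      | add x y hx hy => simp only [map_add, hx, hy, mul_add]
    rw [h1, h2, coproduct_spec]
    simp only [val0_apply, Submodule.coe_smul, ConformalDual.val_smul, eval_X]
    ring
  coskew f := by
    apply val0_tensor_ext
    intro m n a b
    have h : tmulDual (val0 m a) (val0 n b)
        (TensorProduct.comm ℂ (upperZero L) (upperZero L) (coproduct f)) =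
        tmulDual (val0 n b) (val0 m a) (coproduct f) := by
      generalize coproduct f = s
      induction s with
      | zero => simp
      | tmul x y => simp [mul_comm]
      | add x y hx hy => simp only [map_add, hx, hy]
    rw [h]
    trans -(tmulDual (val0 m a) (val0 n b) (coproduct f))
    swap
    · exact (map_neg (tmulDual (val0 m a) (val0 n b)) (coproduct f)).symm
    rw [coproduct_spec, coproduct_spec, val0_apply, val0_apply, val_br_skew]
    congr 3 <;> ring_nf
  cojacobi f := by
    rw [← sub_eq_zero]
    refine tmulDual_separating (fun p : ℂ × L => val0 p.1 p.2)
      (fun p : (ℂ × L) × (ℂ × L) => tmulDual (val0 p.1.1 p.1.2) (val0 p.2.1 p.2.2))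
      val0_separating
      (fun w hw => tmulDual_separating (fun p : ℂ × L => val0 p.1 p.2)
        (fun p : ℂ × L => val0 p.1 p.2) val0_separating val0_separating w
        fun i k => hw (i, k)) _ ?_
    rintro ⟨x, a⟩ ⟨⟨y, b⟩, ⟨z, c⟩⟩
    have h1 : ∀ (x y z : ℂ) (a b c : L) (s : upperZero L ⊗[ℂ] upperZero L),
        tmulDual (val0 x a) (tmulDual (val0 y b) (val0 z c))
          (TensorProduct.map LinearMap.id coproduct s) =
        tmulDual (val0 x a) (val0 (y + z) (br (-y) b c)) s := by
      intro x y z a b c s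
      induction s with
      | zero => simp
      | tmul u v => simp [coproduct_spec]
      | add u v hu hv => simp only [map_add, hu, hv]
    have h2 : ∀ s : upperZero L ⊗[ℂ] (upperZero L ⊗[ℂ] upperZero L),
        tmulDual (val0 x a) (tmulDual (val0 y b) (val0 z c))
          (TensorProduct.leftComm ℂ _ _ _ s) =
        tmulDual (val0 y b) (tmulDual (val0 x a) (val0 z c)) s := by
      intro s
      induction s with
      | zero => simp
      | add u v hu hv => simp only [map_add, hu, hv]
      | tmul u v =>
        induction v with
        | zero => simp
        | add v w hv hw => simp only [TensorProduct.tmul_add, map_add, hv, hw]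
        | tmul v w => simp; ring
    have h3a : ∀ (r : upperZero L ⊗[ℂ] upperZero L) (v : upperZero L),
        tmulDual (val0 x a) (tmulDual (val0 y b) (val0 z c))
          (TensorProduct.assoc ℂ _ _ _ (r ⊗ₜ v)) =
        tmulDual (val0 x a) (val0 y b) r * val0 z c v := by
      intro r v
      induction r with
      | zero => simp
      | add r q hr hq => simp only [TensorProduct.add_tmul, map_add, hr, hq, add_mul]
      | tmul r q => simp; ring
    have h3 : ∀ s : upperZero L ⊗[ℂ] upperZero L,
        tmulDual (val0 x a) (tmulDual (val0 y b) (val0 z c))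
          (TensorProduct.assoc ℂ _ _ _ (TensorProduct.map coproduct LinearMap.id s)) =
        tmulDual (val0 (x + y) (br (-x) a b)) (val0 z c) s := by
      intro s
      induction s with
      | zero => simp
      | tmul u v => rw [TensorProduct.map_tmul, h3a, coproduct_spec, tmulDual_tmul]; rfl
      | add u v hu hv => simp only [map_add, hu, hv]
    simp only [map_sub, h1, h2, h3, coproduct_spec]
    rw [br_jacobi (-x) (-y) a b c, ← neg_add x y]
    simp only [val0_apply, ConformalDual.val_add_right, add_assoc, add_left_comm y x z]
    ring

end UpperZero

end LieConf

end

open Polynomial TensorProduct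

noncomputable section

namespace LieConf

/-! ### Annihilators and the rank of a module separated by functionals -/

section Annihilator

variable {U : Type*} [AddCommGroup U] [Module ℂ U] [Module ℂ[X] U] [IsScalarTower ℂ ℂ[X] U]

/-! Let `N` be a finite-rank subcoalgebra of the upper zero, and let `I ⊆ L` be the set of points
killed by every functional in `N`. The coproduct is dual to the bracket: `f([a_λ b])` is a sum of
products `x(a) y(b)` with `δ(f) = ∑ x ⊗ y`. Since `δ(N) ⊆ N ⊗ N`, every such product vanishes when
`b ∈ I`, so `I` is an ideal (`isIdeal_annihilator`) and simplicity leaves two cases.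

If `I = L`, every functional in `N` is zero, so `N = 0`. If `I = 0`, then `N` separates the points
of `L`, and a finite maximal independent subset `s` of `N` already does so: every element of `N` has
a nonzero multiple in the span of `s`, and `ℂ[λ]` is a domain. Evaluation on `s` then embeds `L` in
`ℂ[λ]^s`, so `L` has finite rank (`hasFiniteRank_of_annihilator_eq_bot`), contrary to assumption. -/

/-- An element of the conformal dual as a `ℂ[∂]`-linear map to `ℂ[λ]`, where `∂` acts on `ℂ[λ]`
as multiplication by `λ`. -/
def ConformalDual.toLinearMap (f : ConformalDual U) : U →ₗ[ℂ[X]] ℂ[X] where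
  toFun := f.1
  map_add' := map_add f.1
  map_smul' p b := by
    induction p using Polynomial.induction_on generalizing b with
    | C r =>
      rw [← algebraMap_eq, algebraMap_smul, map_smul, RingHom.id_apply, algebraMap_smul]
    | add p q hp hq => simp only [add_smul, map_add, hp, hq, RingHom.id_apply]
    | monomial n r h =>
      rw [pow_succ, ← mul_assoc, mul_smul, h, f.2 b]
      simp only [RingHom.id_apply, smul_eq_mul, mul_assoc]

lemma ConformalDual.toLinearMap_eval (f : ConformalDual U) (c : ℂ) (b : U) :
    (f.toLinearMap b).eval c = ConformalDual.val c b f := rfl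

lemma ConformalDual.toLinearMap_add (f g : ConformalDual U) :
    (f + g).toLinearMap = f.toLinearMap + g.toLinearMap := rfl

/-- Evaluation at `b` is only semilinear in `f`, twisted by `λ ↦ -λ`, because `∂` acts on the dual
as `-λ`. -/
lemma ConformalDual.toLinearMap_smul_apply (p : ℂ[X]) (f : ConformalDual U) (b : U) :
    (p • f).toLinearMap b = p.comp (-X) * f.toLinearMap b := rfl

/-- The elements of a `ℂ[∂]`-module annihilated by a set of elements of its conformal dual. -/
def annihilator (S : Set (ConformalDual U)) : Submodule ℂ[X] U :=
  ⨅ f ∈ S, LinearMap.ker f.toLinearMap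

lemma mem_annihilator {S : Set (ConformalDual U)} {b : U} :
    b ∈ annihilator S ↔ ∀ f ∈ S, f.toLinearMap b = 0 := by
  simp [annihilator]

/-- A complex polynomial is determined by its values. This passes to the pointwise form in which the
coproduct is specified. -/
lemma mem_annihilator_iff_val {S : Set (ConformalDual U)} {b : U} :
    b ∈ annihilator S ↔ ∀ f ∈ S, ∀ c, ConformalDual.val c b f = 0 := by
  rw [mem_annihilator]
  refine forall₂_congr fun f _ => ⟨fun h c => ?_, fun h => Polynomial.funext fun c => ?_⟩
  · rw [← ConformalDual.toLinearMap_eval, h, eval_zero]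
  · rw [ConformalDual.toLinearMap_eval, h, eval_zero]

/-- The elements of the conformal dual that vanish at a given point. -/
def dualAnnihilator (b : U) : Submodule ℂ[X] (ConformalDual U) where
  carrier := {f | f.toLinearMap b = 0}
  add_mem' {f g} hf hg := by
    simp only [Set.mem_ofPred_eq] at hf hg ⊢
    rw [ConformalDual.toLinearMap_add, LinearMap.add_apply, hf, hg, add_zero]
  zero_mem' := rfl
  smul_mem' p f hf := by
    simp only [Set.mem_ofPred_eq] at hf ⊢
    rw [ConformalDual.toLinearMap_smul_apply, hf, mul_zero]

lemma mem_dualAnnihilator {b : U} {f : ConformalDual U} :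
    f ∈ dualAnnihilator b ↔ f.toLinearMap b = 0 := Iff.rfl

/-- Saturation: `p(-λ)` is nonzero when `p` is, and `ℂ[λ]` is a domain. It is needed because a
maximal independent set spans its module only up to torsion. -/
lemma mem_dualAnnihilator_of_smul_mem {b : U} {f : ConformalDual U} {p : ℂ[X]} (hp : p ≠ 0)
    (h : p • f ∈ dualAnnihilator b) : f ∈ dualAnnihilator b := by
  rw [mem_dualAnnihilator, ConformalDual.toLinearMap_smul_apply] at h
  refine (mul_eq_zero.mp h).resolve_left fun h0 => hp ?_
  -- The substitution `λ ↦ -λ` is an involution, so applying it again recovers `p = 0`.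
  have h1 := congrArg (fun q : ℂ[X] => q.comp (-X)) h0
  simpa [comp_assoc] using h1

/-- A `ℂ[∂]`-module whose points are separated by a finite rank submodule of its conformal dual
has finite rank. -/
lemma hasFiniteRank_of_annihilator_eq_bot (V : Submodule ℂ[X] (ConformalDual U))
    (hV : HasFiniteRank V) (h : annihilator (V : Set (ConformalDual U)) = ⊥) :
    HasFiniteRank U := by
  obtain ⟨s, hs, hmax⟩ := exists_maximal_linearIndepOn ℂ[X] (id : V → V)
  have hfin : Finite s := by
    have h1 := hs.cardinal_le_rank
    exact Cardinal.mk_lt_aleph0_iff.mp (h1.trans_lt hV)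
  let ev : U →ₗ[ℂ[X]] (s → ℂ[X]) := LinearMap.pi fun f => f.1.1.toLinearMap
  have hev : Function.Injective ev := by
    rw [← LinearMap.ker_eq_bot, eq_bot_iff, ← h]
    intro b hb
    rw [mem_annihilator]
    -- The functionals killing `b` form a submodule containing `s`, hence its span; saturation
    -- extends this to all of `V`.
    have hspan : Submodule.span ℂ[X] (id '' s) ≤ (dualAnnihilator b).comap V.subtype := by
      rw [Submodule.span_le]
      rintro _ ⟨f, hf, rfl⟩
      exact congrFun (LinearMap.mem_ker.mp hb) ⟨f, hf⟩
    intro f hf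
    by_cases hfs : (⟨f, hf⟩ : V) ∈ s
    · exact hspan (Submodule.subset_span ⟨_, hfs, rfl⟩)
    · obtain ⟨p, hp, hpf⟩ := hmax _ hfs
      -- By maximality of `s`, the multiple `p • f` with `p ≠ 0` lies in the span.
      exact mem_dualAnnihilator_of_smul_mem hp (hspan hpf)
  have hle := LinearMap.lift_rank_le_of_injective ev hev
  have hlt : Module.rank ℂ[X] (s → ℂ[X]) < Cardinal.aleph0 := Module.rank_lt_aleph0 _ _
  rw [HasFiniteRank, ← Cardinal.lift_lt_aleph0]
  exact hle.trans_lt (Cardinal.lift_lt_aleph0.mpr hlt)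

end Annihilator

/-! ### Subcoalgebras and ideals -/

section Subcoalgebra

variable {L : Type*} [AddCommGroup L] [Module ℂ L] [Module ℂ[X] L] [IsScalarTower ℂ ℂ[X] L]
  [LieConformalAlgebra L]

/-- The annihilator of a subcoalgebra of the upper zero is an ideal. -/
lemma isIdeal_annihilator {N : Submodule ℂ[X] (upperZero L)} (hN : IsSubcoalgebra N) :
    IsIdeal (annihilator (N.map (upperZero L).subtype : Set (ConformalDual L))) := by
  intro a b hb l
  rw [mem_annihilator_iff_val] at hb ⊢
  rintro _ ⟨f, hf, rfl⟩ c
  obtain ⟨t, ht⟩ := hN f hf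
  -- The arguments `-l` and `c + l` are chosen so that the right-hand side becomes `f_c([a_l b])`.
  have h := coproduct_spec f (-l) (c + l) a b
  rw [neg_neg, neg_add_cancel_comm_assoc] at h
  change val0 c (br l a b) f = 0
  rw [← h]
  change tensorIncl N t = coproduct f at ht
  rw [← ht]
  clear ht
  induction t with
  | zero => simp
  | tmul x y =>
    -- The second tensor factor lies in `N`, so it kills `b`; the first factor plays no role.
    have hy : val0 (c + l) b y.1 = 0 := hb _ ⟨y.1, y.2, rfl⟩ _
    change tmulDual _ _ (x.1 ⊗ₜ[ℂ] y.1) = 0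
    rw [tmulDual_tmul, hy, mul_zero]
  | add x y hx hy => rw [map_add, map_add, hx, hy, add_zero]

end Subcoalgebra

end LieConf

end

theorem corollary4p4 {L : Type*} [AddCommGroup L] [Module ℂ L] [Module ℂ[X] L]
    [IsScalarTower ℂ ℂ[X] L] [LieConf.LieConformalAlgebra L]
    (hrank : ¬ LieConf.HasFiniteRank L) (hsimple : LieConf.IsSimple L) :
    LieConf.Loc (LieConf.upperZero L) = ⊥ := by
  rw [LieConf.Loc, sSup_eq_bot]
  rintro N ⟨hN, hfin⟩
  rcases hsimple.2 _ (LieConf.isIdeal_annihilator hN) with h | h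
  · refine absurd (LieConf.hasFiniteRank_of_annihilator_eq_bot _ ?_ h) hrank
    -- Passing from `N` to its image in the full conformal dual does not increase the rank.
    exact (rank_map_le (LieConf.upperZero L).subtype N).trans_lt hfin
  · rw [eq_bot_iff]
    intro f hf
    -- Here the annihilator is all of `L`, so `f` vanishes at every point and every `λ`.
    refine LieConf.val0_separating f fun p => ?_
    have hp : p.2 ∈ LieConf.annihilator
        (N.map (LieConf.upperZero L).subtype : Set (LieConf.ConformalDual L)) := h ▸ trivial
    exact LieConf.mem_annihilator_iff_val.mp hp _ ⟨f, hf, rfl⟩ p.1
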